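/- Let $k$ be a natural number and let $L=(l_1,\dots,l_k)$ be positive real numbers with $l_1+\dots+l_k=1$ such that $p_1l_1+\dots+p_kl_k\neq 0$ for every $p\in\mathbb Z^k\setminus\{0\}$. For $x$ in the circle $C=\mathbb R/\mathbb Z$ and a permutation $\sigma\in S_k$ put \[ \Delta(x;\sigma)=\{x,\;x+l_{\sigma(1)},\;x+l_{\sigma(1)}+l_{\sigma(2)},\;\dots,\;x+l_{\sigma(1)}+\dots+l_{\sigma(k-1)}\}\subset C, \] and let the full tonnetz be the abstract simplicial complex with vertex set $C$ whose simplices are the nonempty subsets of the sets $\Delta(x;\sigma)$, $x\in C$, $\sigma\in S_k$. Let $H_0=\{x\in\mathbb R^k\mid x_1+\dots+x_k=0\}\cong\mathbb R^{k-1}$ with the Euclidean metric, and let \[ \Lambda=\{x\in\mathbb Z^k\cap H_0\mid x_1\equiv x_2\equiv\dots\equiv x_k \pmod k\} \] be the permutohedral lattice $\mathbb A^*_{k-1}$ (up to scaling, the dual of the root lattice $\mathbb Z^k\cap H_0$). A Delone cell of $\Lambda$ is the convex hull of the set of all points of $\Lambda$ on a sphere in $H_0$ that has no point of $\Lambda$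 in its interior, provided that this set affinely spans $H_0$. Theorem. The Delone cells of $\Lambda$ are simplices and, together with their faces, they form a triangulation $\mathcal D_\Lambda$ of $H_0$ (the Delone triangulation); and every connected component of the full tonnetz is isomorphic, as a simplicial complex, to $\mathcal D_\Lambda$. -/

import Mathlib

namespace Tonnetz

/-! ### Simplicial complexes: vertices, isomorphisms, connected components -/

/-- The vertices of an abstract simplicial complex. -/
def vertexSet {α : Type*} (K : PreAbstractSimplicialComplex α) : Set α :=
  {v | {v} ∈ K.faces}

/-- Two simplicial complexes are isomorphic if some bijection between their vertex sets takes
simplices to simplices in both directions. -/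
def Isomorphic {α β : Type*} (K : PreAbstractSimplicialComplex α)
    (K' : PreAbstractSimplicialComplex β) : Prop :=
  ∃ e : vertexSet K ≃ vertexSet K', ∀ s : Finset (vertexSet K),
    s.map (Function.Embedding.subtype _) ∈ K.faces ↔
      (s.map e.toEmbedding).map (Function.Embedding.subtype _) ∈ K'.faces

/-- The graph (1-skeleton) of a simplicial complex: two distinct points are adjacent if they lie in
a common simplex. -/
def skeletonGraph {α : Type*} (K : PreAbstractSimplicialComplex α) : SimpleGraph α where
  Adj u v := u ≠ v ∧ ∃ s ∈ K.faces, u ∈ s ∧ v ∈ s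
  symm := ⟨fun _ _ h => ⟨h.1.symm, h.2.imp fun _ hs => ⟨hs.1, hs.2.2, hs.2.1⟩⟩⟩
  loopless := ⟨fun _ h => h.1 rfl⟩

/-- The connected component of the vertex `x` in a simplicial complex: all simplices whose vertices
can be joined to `x` by an edge path. -/
def component {α : Type*} (K : PreAbstractSimplicialComplex α) (x : α) :
    PreAbstractSimplicialComplex α where
  faces := {s | s ∈ K.faces ∧ ∀ v ∈ s, (skeletonGraph K).Reachable x v}
  isRelLowerSet_faces := fun _ hs =>
    ⟨(K.isRelLowerSet_faces hs.1).1, fun _ hts ht =>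
      ⟨(K.isRelLowerSet_faces hs.1).2 hts ht, fun v hv => hs.2 v (hts hv)⟩⟩

/-! ### The irrational tonnetz on the circle `ℝ / ℤ` -/

/-- The set `Δ(x; σ) = {x, x + l_{σ(1)}, …, x + l_{σ(1)} + ⋯ + l_{σ(k-1)}}` in the circle `ℝ / ℤ`. -/
def maximalSimplex {k : ℕ} (L : Fin k → ℝ) (x : UnitAddCircle) (σ : Equiv.Perm (Fin k)) :
    Set UnitAddCircle :=
  Set.range fun j : Fin k => x + ((∑ i ∈ Finset.Iio j, L (σ i) : ℝ) : UnitAddCircle)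

/-- The full tonnetz: its simplices are the `L`-admissible sets, that is, the nonempty subsets of
the sets `Δ(x; σ)`. -/
def fullTonnetz {k : ℕ} (L : Fin k → ℝ) : PreAbstractSimplicialComplex UnitAddCircle where
  faces := {s | s.Nonempty ∧ ∃ (x : UnitAddCircle) (σ : Equiv.Perm (Fin k)),
    (s : Set UnitAddCircle) ⊆ maximalSimplex L x σ}
  isRelLowerSet_faces := fun _ hs =>
    ⟨hs.1, fun _ hts ht => ⟨ht, hs.2.imp fun _ h => h.imp fun _ hσ =>
      (Finset.coe_subset.2 hts).trans hσ⟩⟩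

/-! ### Delone triangulations -/

section Delone

variable {V : Type*} [NormedAddCommGroup V] [InnerProductSpace ℝ V]

/-- `P` is the set of vertices of a (full-dimensional) Delone cell of the point set `Λ`: it consists
of all the points of `Λ` on some sphere with no point of `Λ` inside, and it affinely spans the
whole space. The cell itself is the convex hull of `P`. -/
def IsDeloneCell (Λ P : Set V) : Prop :=
  ∃ (c : V) (r : ℝ), (∀ z ∈ Λ, r ≤ dist z c) ∧ P = {z ∈ Λ | dist z c = r} ∧ affineSpan ℝ P = ⊤

/-- `D` is the Delone triangulation of `V` associated to `Λ`: a geometric simplicial complex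
which fills the whole space, and whose simplices are the Delone cells of `Λ` and their faces.
(Simplices of a `Geometry.SimplicialComplex` have affinely independent vertices and meet in common
faces, so this includes the fact that all Delone cells are simplices.) -/
structure IsDeloneTriangulation (Λ : Set V) (D : Geometry.SimplicialComplex ℝ V) : Prop where
  space_eq : D.space = Set.univ
  mem_faces_iff : ∀ s : Finset V,
    s ∈ D.faces ↔ s.Nonempty ∧ ∃ P : Set V, IsDeloneCell Λ P ∧ (s : Set V) ⊆ P

end Delone

/-! ### The permutohedral lattice -/

/-- The `(k - 1)`-dimensional Euclidean space `H₀ = {x ∈ ℝ^k | x_1 + ⋯ + x_k = 0}`. -/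
def sumZeroSpace (k : ℕ) : Submodule ℝ (EuclideanSpace ℝ (Fin k)) where
  carrier := {x | ∑ i, x i = 0}
  add_mem' := fun {x y} (hx : ∑ i, x i = 0) (hy : ∑ i, y i = 0) => by
    simp [Finset.sum_add_distrib, hx, hy]
  zero_mem' := by simp
  smul_mem' := fun c x (hx : ∑ i, x i = 0) => by
    simp [← Finset.mul_sum, hx]

/-- The permutohedral lattice `A*_{k-1}` in `H₀`: the vectors of `H₀` with integer coordinates which
are all congruent modulo `k`. (This is the dual of the root lattice `A_{k-1} = H₀ ∩ ℤ^k`, scaled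
by `k`.) -/
def permutohedralLattice (k : ℕ) : AddSubgroup (sumZeroSpace k) where
  carrier := {x | ∃ z : Fin k → ℤ, (∀ i, x.1 i = z i) ∧ ∀ i j, z i ≡ z j [ZMOD k]}
  add_mem' := by
    rintro x y ⟨z, hz, hz'⟩ ⟨w, hw, hw'⟩
    exact ⟨z + w, fun i => by simp [hz, hw], fun i j => (hz' i j).add (hw' i j)⟩
  zero_mem' := ⟨0, fun i => by simp, fun i j => rfl⟩
  neg_mem' := by
    rintro x ⟨z, hz, hz'⟩
    exact ⟨-z, fun i => by simp [hz], fun i j => (hz' i j).neg⟩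

end Tonnetz

namespace Tonnetz

/-! ### Sums of squared differences of distinct integers -/

/-! Both complexes are quotients of one structure on `ℤ ^ k`. The maps `circlePoint L x` and
`latticePoint` identify exactly the integer vectors that differ by a constant vector
(`circlePoint_eq_iff`, `latticePoint_eq_iff`), and both send the staircases `n, n + e_{σ 0}, n +
e_{σ 0} + e_{σ 1}, …` to the maximal simplices.

It remains to see that the staircase cells form the Delone triangulation. Up to the factor `2k`, the
squared distance from a lattice point to the centre of a cell is the sum of squared differences of
`k` integers with distinct residues mod `k`. Such a sum is minimal exactly when the integers are
consecutive (`sum_sum_sq_sub_eq_iff`), and this singles out the vertices of the cell, so its sphere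
is empty (`cellVertices_eq`). The cells cover `H₀`: take integer parts and sort the fractional
parts. For two empty spheres the difference of powers is affine, with opposite signs on the two
vertex sets. Hence cells meet in common faces, and every Delone cell lies in a staircase cell. -/

lemma abs_sub_le_abs_sub_of_strictMono {k : ℕ} {b : Fin k → ℤ} (hb : StrictMono b) (i j : Fin k) :
    |(i : ℤ) - j| ≤ |b i - b j| := by
  have key : ∀ d : ℕ, ∀ i j : Fin k, (j : ℕ) = i + d → (d : ℤ) ≤ b j - b i := by
    intro d
    induction d with
    | zero =>
      intro i j h
      have : i = j := Fin.ext (by omega)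
      simp [this]
    | succ d ih =>
      intro i j h
      have h1 := ih i ⟨i + d, by omega⟩ rfl
      have h2 : b ⟨i + d, by omega⟩ < b j := hb (Fin.lt_def.2 (by simp; omega))
      push_cast
      omega
  rcases le_total i j with h | h
  · have h' : (i : ℕ) ≤ j := h
    have := key (j - i) i j (by omega)
    have h3 := neg_le_abs (b i - b j)
    rw [abs_of_nonpos (by omega)]
    omega
  · have h' : (j : ℕ) ≤ i := h
    have := key (i - j) j i (by omega)
    have h3 := le_abs_self (b i - b j)
    rw [abs_of_nonneg (by omega)]
    omega

lemma strictMono_comp_sort {k : ℕ} {a : Fin k → ℤ} (ha : Function.Injective a) :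
    StrictMono (a ∘ Tuple.sort a) :=
  (Tuple.monotone_sort a).strictMono_of_injective (ha.comp (Tuple.sort a).injective)

lemma sum_sum_sq_sub_comp_perm {k : ℕ} (a : Fin k → ℤ) (τ : Equiv.Perm (Fin k)) :
    ∑ i, ∑ j, (a (τ i) - a (τ j)) ^ 2 = ∑ i, ∑ j, (a i - a j) ^ 2 := by
  rw [← Equiv.sum_comp τ (fun i => ∑ j, (a i - a j) ^ 2)]
  exact Finset.sum_congr rfl fun i _ => Equiv.sum_comp τ (fun j => (a (τ i) - a j) ^ 2)

lemma sum_sum_sq_sub_le {k : ℕ} {a : Fin k → ℤ} (ha : Function.Injective a) :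
    ∑ i : Fin k, ∑ j : Fin k, ((i : ℤ) - j) ^ 2 ≤ ∑ i, ∑ j, (a i - a j) ^ 2 := by
  rw [← sum_sum_sq_sub_comp_perm a (Tuple.sort a)]
  exact Finset.sum_le_sum fun i _ => Finset.sum_le_sum fun j _ =>
    sq_le_sq.2 (abs_sub_le_abs_sub_of_strictMono (strictMono_comp_sort ha) i j)

/-- The sum of squared differences of `k` distinct integers is minimal exactly if the integers are
consecutive. -/
lemma sum_sum_sq_sub_eq_iff {k : ℕ} {a : Fin k → ℤ} (ha : Function.Injective a) :
    ∑ i, ∑ j, (a i - a j) ^ 2 = ∑ i : Fin k, ∑ j : Fin k, ((i : ℤ) - j) ^ 2 ↔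
      ∀ i j, |a i - a j| < k := by
  have hb := abs_sub_le_abs_sub_of_strictMono (strictMono_comp_sort ha)
  have hm := strictMono_comp_sort ha
  set τ := Tuple.sort a
  rw [← sum_sum_sq_sub_comp_perm a τ]
  constructor
  · intro h i j
    -- Termwise bounds with equal totals are equalities, first for each row, then for each entry.
    have h1 := (Finset.sum_eq_sum_iff_of_le fun i _ => Finset.sum_le_sum fun j _ =>
      sq_le_sq.2 (hb i j)).1 h.symm (τ.symm i) (Finset.mem_univ _)
    have h2 := (Finset.sum_eq_sum_iff_of_le fun j _ => sq_le_sq.2 (hb (τ.symm i) j)).1 h1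
      (τ.symm j) (Finset.mem_univ _)
    rw [sq_eq_sq_iff_abs_eq_abs] at h2
    simp only [Function.comp, Equiv.apply_symm_apply] at h2
    rw [← h2, abs_lt]
    constructor <;> omega
  · intro h
    refine Finset.sum_congr rfl fun i _ => Finset.sum_congr rfl fun j _ => ?_
    have hk : 0 < k := i.pos
    -- Squeeze: `a (τ i)` is at least `i` above the minimum and at least `k - 1 - i` below the
    -- maximum, while the spread is at most `k - 1`.
    have key : ∀ i : Fin k, a (τ i) - i = a (τ ⟨0, hk⟩) := by
      intro i
      have h0 := hb i ⟨0, hk⟩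
      have h1 := hb ⟨k - 1, by omega⟩ i
      have h2 := h (τ ⟨k - 1, by omega⟩) (τ ⟨0, hk⟩)
      have m0 : a (τ ⟨0, hk⟩) ≤ a (τ i) := hm.monotone (Fin.le_def.2 (by simp))
      have m1 : a (τ i) ≤ a (τ ⟨k - 1, by omega⟩) :=
        hm.monotone (Fin.le_def.2 (by simp; omega))
      simp only [Function.comp] at h0 h1
      rw [abs_of_nonneg (by omega)] at h2
      rw [abs_of_nonneg (by simp), abs_of_nonneg (by omega)] at h0
      rw [abs_of_nonneg (by simp; omega), abs_of_nonneg (by omega)] at h1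
      push_cast [Nat.cast_sub (show 1 ≤ k from hk)] at h0 h1
      omega
    have h1 := key i
    have h2 := key j
    congr 1
    omega

/-! ### Empty spheres -/

section Spheres

variable {V : Type*} [NormedAddCommGroup V] [InnerProductSpace ℝ V]

/-- The difference of the powers of a point with respect to two spheres is an affine function. -/
lemma exists_inner_add_eq_power_sub (c c' : V) (r r' : ℝ) : ∃ (a : V) (b : ℝ), ∀ z : V,
    (dist z c' ^ 2 - r' ^ 2) - (dist z c ^ 2 - r ^ 2) = inner ℝ a z + b := by
  refine ⟨(2 : ℝ) • (c - c'), ‖c'‖ ^ 2 - r' ^ 2 - (‖c‖ ^ 2 - r ^ 2), fun z => ?_⟩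
  rw [dist_eq_norm, dist_eq_norm, norm_sub_sq_real, norm_sub_sq_real, inner_smul_left,
    inner_sub_left, real_inner_comm z c, real_inner_comm z c']
  simp
  ring

lemma inner_sum_smul_add {s : Finset V} {w : V → ℝ} (hw : ∑ v ∈ s, w v = 1) (a : V) (b : ℝ) :
    inner ℝ a (∑ v ∈ s, w v • v) + b = ∑ v ∈ s, w v * (inner ℝ a v + b) := by
  simp only [mul_add, Finset.sum_add_distrib, ← Finset.sum_mul, hw, inner_sum, inner_smul_right,
    one_mul]

variable {Λ : Set V} {c c' : V} {r r' : ℝ}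

/-- If a convex combination of points of `Λ` on an empty sphere lies in the convex hull of the
points of `Λ` on another empty sphere, then the points that occur in the combination lie on that
other sphere. -/
lemma dist_eq_of_sum_mem_convexHull (hc : ∀ z ∈ Λ, r ≤ dist z c) (hc' : ∀ z ∈ Λ, r' ≤ dist z c')
    {s : Finset V} (hs : (s : Set V) ⊆ {z ∈ Λ | dist z c = r}) {w : V → ℝ}
    (hw0 : ∀ v ∈ s, 0 ≤ w v) (hw1 : ∑ v ∈ s, w v = 1)
    (hx : ∑ v ∈ s, w v • v ∈ convexHull ℝ {z ∈ Λ | dist z c' = r'}) :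
    ∀ v ∈ s, 0 < w v → dist v c' = r' := by
  obtain ⟨a, b, hab⟩ := exists_inner_add_eq_power_sub c c' r r'
  have hr : 0 ≤ r := by
    obtain ⟨v, hv⟩ : s.Nonempty := by
      rw [Finset.nonempty_iff_ne_empty]
      rintro rfl
      simp at hw1
    rw [← (hs hv).2]
    exact dist_nonneg
  have hr' : 0 ≤ r' := by
    obtain ⟨v, hv⟩ := convexHull_nonempty_iff.1 ⟨_, hx⟩
    rw [← hv.2]
    exact dist_nonneg
  -- The affine form is `≤ 0` on the second vertex set and `≥ 0` on `s`. At a common point it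
  -- vanishes, so every term with positive weight vanishes.
  have h1 : convexHull ℝ {z ∈ Λ | dist z c' = r'} ⊆ {z | inner ℝ a z + b ≤ 0} := by
    refine convexHull_min ?_ ?_
    · rintro z ⟨hz, hz'⟩
      have := hc z hz
      simp only [Set.mem_ofPred_eq, ← hab, hz']
      nlinarith
    · have := convex_halfSpace_le (𝕜 := ℝ) (innerSL ℝ a).toLinearMap.isLinear (-b)
      convert! this using 2
      ext z
      simp [← le_neg_iff_add_nonpos_right]
  have h2 : ∀ v ∈ s, 0 ≤ inner ℝ a v + b := by
    intro v hv
    have := hc' v (hs hv).1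
    rw [← hab, (hs hv).2]
    nlinarith
  have h3 := h1 hx
  rw [Set.mem_ofPred_eq, inner_sum_smul_add hw1] at h3
  have h4 := (Finset.sum_eq_zero_iff_of_nonneg
    fun v hv => mul_nonneg (hw0 v hv) (h2 v hv)).1
    (le_antisymm h3 (Finset.sum_nonneg fun v hv => mul_nonneg (hw0 v hv) (h2 v hv)))
  intro v hv hpos
  have h5 := (mul_eq_zero.1 (h4 v hv)).resolve_left hpos.ne'
  rw [← hab, (hs hv).2] at h5
  exact (sq_eq_sq₀ dist_nonneg hr').1 (by linarith)

/-- Discarding the zero weights leaves a convex combination of points lying on both spheres. -/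
lemma mem_convexHull_inter_of_mem_convexHull (hc : ∀ z ∈ Λ, r ≤ dist z c)
    (hc' : ∀ z ∈ Λ, r' ≤ dist z c') {s : Finset V} (hs : (s : Set V) ⊆ {z ∈ Λ | dist z c = r})
    {x : V} (hxs : x ∈ convexHull ℝ (s : Set V))
    (hx : x ∈ convexHull ℝ {z ∈ Λ | dist z c' = r'}) :
    x ∈ convexHull ℝ ((s : Set V) ∩ {z ∈ Λ | dist z c' = r'}) := by
  classical
  obtain ⟨w, hw0, hw1, rfl⟩ := Finset.mem_convexHull'.1 hxs
  have h := dist_eq_of_sum_mem_convexHull hc hc' hs hw0 hw1 hx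
  have hne : ∀ v ∈ s, v ∉ s.filter (fun v => 0 < w v) → w v = 0 := by
    intro v hv hv'
    rw [Finset.mem_filter, not_and] at hv'
    exact le_antisymm (not_lt.1 (hv' hv)) (hw0 v hv)
  refine convexHull_mono (s := (s.filter (fun v => 0 < w v) : Finset V)) ?_
    (Finset.mem_convexHull'.2 ⟨w, fun v hv => hw0 v (Finset.mem_filter.1 hv).1, ?_, ?_⟩)
  · intro v hv
    have hv' := Finset.mem_filter.1 (Finset.mem_coe.1 hv)
    exact ⟨hv'.1, (hs hv'.1).1, h v hv'.1 hv'.2⟩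
  · rw [← hw1]
    exact Finset.sum_subset (Finset.filter_subset _ _) hne
  · exact Finset.sum_subset (Finset.filter_subset _ _) fun v hv hv' => by simp [hne v hv hv']

/-- If the centroid of spanning points of `Λ` on an empty sphere lies in the convex hull of the points
of `Λ` on another empty sphere, then all the points on the first sphere lie on the second. -/
lemma subset_of_centroid_mem_convexHull (hc : ∀ z ∈ Λ, r ≤ dist z c)
    (hc' : ∀ z ∈ Λ, r' ≤ dist z c') {s : Finset V} (hs : (s : Set V) ⊆ {z ∈ Λ | dist z c = r})
    (hne : s.Nonempty) (hspan : affineSpan ℝ (s : Set V) = ⊤)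
    (hx : ∑ v ∈ s, (s.card : ℝ)⁻¹ • v ∈ convexHull ℝ {z ∈ Λ | dist z c' = r'}) :
    {z ∈ Λ | dist z c = r} ⊆ {z ∈ Λ | dist z c' = r'} := by
  have hcard : (0 : ℝ) < s.card := by exact_mod_cast hne.card_pos
  have h := dist_eq_of_sum_mem_convexHull hc hc' hs (w := fun _ => (s.card : ℝ)⁻¹)
    (fun v _ => by positivity) (by simp [hcard.ne']) hx
  obtain ⟨a, b, hab⟩ := exists_inner_add_eq_power_sub c c' r r'
  have h0 : ∀ v ∈ s, inner ℝ a v + b = 0 := fun v hv => by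
    rw [← hab, (hs hv).2, h v hv (by positivity)]
    ring
  have hr' : 0 ≤ r' := by
    obtain ⟨v, hv⟩ := hne
    rw [← h v hv (by positivity)]
    exact dist_nonneg
  -- An affine function vanishing on a spanning set is zero, so the two spheres assign every point
  -- the same power.
  have h1 : ∀ z : V, inner ℝ a z + b = 0 := by
    intro z
    have hz : z ∈ affineSpan ℝ (s : Set V) := hspan ▸ AffineSubspace.mem_top ℝ V z
    refine affineSpan_induction (p := fun z => inner ℝ a z + b = 0) hz h0 fun t u v w hu hv hw => ?_
    simp only [vsub_eq_sub, vadd_eq_add, inner_add_right, inner_smul_right, inner_sub_right]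
    linear_combination t * (hu - hv) + hw
  rintro z ⟨hz, hzr⟩
  refine ⟨hz, (sq_eq_sq₀ dist_nonneg hr').1 ?_⟩
  have := hab z
  rw [h1, hzr] at this
  linarith

end Spheres

/-! ### Isomorphisms from a common parametrisation of the vertices -/

lemma isomorphic_of_parametrisation {A α β : Type*} [DecidableEq α] [DecidableEq β]
    {K : PreAbstractSimplicialComplex α} {K' : PreAbstractSimplicialComplex β}
    (φ : A → α) (ψ : A → β) (hφ : Set.range φ = vertexSet K) (hψ : Set.range ψ = vertexSet K')
    (hker : ∀ a b, φ a = φ b ↔ ψ a = ψ b)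
    (hfaces : ∀ s : Finset A, s.image φ ∈ K.faces ↔ s.image ψ ∈ K'.faces) :
    Isomorphic K K' := by
  classical
  have h1 : ∀ u : vertexSet K, ∃ a, φ a = u := fun u => (Set.ext_iff.1 hφ u).2 u.2
  have h2 : ∀ u : vertexSet K', ∃ a, ψ a = u := fun u => (Set.ext_iff.1 hψ u).2 u.2
  choose f hf using h1
  choose g hg using h2
  let e : vertexSet K ≃ vertexSet K' :=
    { toFun := fun u => ⟨ψ (f u), hψ ▸ Set.mem_range_self _⟩
      invFun := fun v => ⟨φ (g v), hφ ▸ Set.mem_range_self _⟩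
      left_inv := fun u => Subtype.ext (by
        rw [← hf u]
        exact (hker _ _).2 (hg _))
      right_inv := fun v => Subtype.ext (by
        rw [← hg v]
        exact (hker _ _).1 (hf _)) }
  refine ⟨e, fun s => ?_⟩
  have := hfaces (s.image f)
  rw [Finset.image_image, Finset.image_image] at this
  convert! this using 2
  · ext v
    simp [hf]
  · rw [Finset.map_map, Finset.map_eq_image]
    rfl

/-! ### The lattice as an image of `ℤ ^ k` -/

/-- The map `y ↦ k y - (∑ y) 1` from `ℝ ^ k` onto `H₀`, whose kernel consists of the constant
vectors. -/
noncomputable def toSumZero (k : ℕ) : (Fin k → ℝ) →ₗ[ℝ] sumZeroSpace k where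
  toFun y := ⟨WithLp.toLp 2 fun i => k * y i - ∑ j, y j, by
    change ∑ i, (k * y i - ∑ j, y j) = 0
    simp [Finset.sum_sub_distrib, ← Finset.mul_sum]⟩
  map_add' y z := by
    ext i
    simp [Finset.sum_add_distrib]
    ring
  map_smul' c y := by
    ext i
    simp [← Finset.mul_sum]
    ring

lemma toSumZero_apply {k : ℕ} (y : Fin k → ℝ) (i : Fin k) :
    (toSumZero k y).1 i = k * y i - ∑ j, y j := rfl

lemma toSumZero_eq_iff {k : ℕ} (y z : Fin k → ℝ) :
    toSumZero k y = toSumZero k z ↔ ∀ i j, y i - z i = y j - z j := by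
  constructor
  · intro h i j
    have hi := congrArg (fun v => v.1 i) h
    have hj := congrArg (fun v => v.1 j) h
    simp only [toSumZero_apply] at hi hj
    have hk : (k : ℝ) ≠ 0 := by exact_mod_cast i.pos.ne'
    apply mul_left_cancel₀ hk
    linarith
  · intro h
    ext i
    rw [toSumZero_apply, toSumZero_apply]
    have : ∑ j, (y j - z j) = k * (y i - z i) := by
      rw [Finset.sum_congr rfl fun j _ => h j i]
      simp [mul_sub]
    rw [Finset.sum_sub_distrib] at this
    linarith

lemma toSumZero_surjective {k : ℕ} : Function.Surjective (toSumZero k) := by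
  intro x
  refine ⟨fun i => x.1 i / k, ?_⟩
  ext i
  have hk : (k : ℝ) ≠ 0 := by exact_mod_cast i.pos.ne'
  have hx : ∑ i, x.1 i = 0 := x.2
  rw [toSumZero_apply, ← Finset.sum_div, hx]
  field_simp
  simp

/-- For a vector `v` of sum zero, `2k ∑ v_i² = ∑ (v_i - v_j)²`; passing to differences cancels the
mean. -/
lemma mul_norm_toSumZero_sq {k : ℕ} (y : Fin k → ℝ) :
    2 * k * ‖toSumZero k y‖ ^ 2 = ∑ i, ∑ j, (k * y i - k * y j) ^ 2 := by
  have h : ‖toSumZero k y‖ ^ 2 = ∑ i, (k * y i - ∑ j, y j) ^ 2 := by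
    rw [Submodule.coe_norm, EuclideanSpace.norm_sq_eq]
    simp [toSumZero_apply]
  rw [h]
  simp only [sub_sq, Finset.sum_add_distrib, Finset.sum_sub_distrib, ← Finset.mul_sum,
    ← Finset.sum_mul, mul_pow, mul_assoc, mul_left_comm _ (k : ℝ), Finset.sum_const,
    Finset.card_univ, Fintype.card_fin, nsmul_eq_mul]
  ring

/-- The parametrisation of the permutohedral lattice by `ℤ ^ k`. -/
noncomputable def latticePoint {k : ℕ} (n : Fin k → ℤ) : sumZeroSpace k :=
  toSumZero k fun i => (n i : ℝ)

lemma latticePoint_eq_iff {k : ℕ} (n m : Fin k → ℤ) :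
    latticePoint n = latticePoint m ↔ ∀ i j, n i - m i = n j - m j := by
  rw [latticePoint, latticePoint, toSumZero_eq_iff]
  exact_mod_cast Iff.rfl

lemma range_latticePoint {k : ℕ} :
    Set.range (latticePoint (k := k)) = (permutohedralLattice k : Set (sumZeroSpace k)) := by
  ext x
  constructor
  · rintro ⟨n, rfl⟩
    refine ⟨fun i => k * n i - ∑ j, n j, fun i => ?_, fun i j => ?_⟩
    · rw [latticePoint, toSumZero_apply]
      push_cast
      rfl
    · rw [Int.modEq_iff_dvd]
      exact ⟨n j - n i, by ring⟩
  · rintro ⟨z, hz, hz'⟩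
    rcases Nat.eq_zero_or_pos k with rfl | hk
    · exact ⟨0, Subtype.ext (PiLp.ext fun i => i.elim0)⟩
    have hx : ∑ i, x.1 i = 0 := x.2
    have h0 : ∑ i, z i = 0 := by
      simp only [hz] at hx
      exact_mod_cast hx
    -- Write `z i = z 0 + k * m i`; since `∑ z = 0`, `∑ m = -z 0`, so `m` is a preimage.
    choose m hm using fun i => (Int.modEq_iff_dvd.1 (hz' ⟨0, hk⟩ i))
    refine ⟨m, ?_⟩
    ext i
    rw [latticePoint, toSumZero_apply, hz]
    have h1 : ∑ j, (z j - z ⟨0, hk⟩) = ∑ j, k * m j := Finset.sum_congr rfl fun j _ => hm j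
    rw [Finset.sum_sub_distrib, h0, ← Finset.mul_sum] at h1
    simp only [Finset.sum_const, Finset.card_univ, Fintype.card_fin, nsmul_eq_mul] at h1
    have h2 : ∑ j, m j = - z ⟨0, hk⟩ := by
      apply mul_left_cancel₀ (show (k : ℤ) ≠ 0 by exact_mod_cast hk.ne')
      linarith
    have h3 := hm i
    have h4 : k * m i - ∑ j, m j = z i := by rw [h2]; linarith
    have h5 := congrArg (Int.cast (R := ℝ)) h4
    push_cast at h5
    exact h5

/-! ### The cells of the permutohedral lattice -/

/-- The point reached from `n` by `j` unit steps in the directions `σ 0`, `σ 1`, … -/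
def staircase {k : ℕ} (n : Fin k → ℤ) (σ : Equiv.Perm (Fin k)) (j : Fin k) : Fin k → ℤ :=
  fun i => n i + if σ.symm i < j then 1 else 0

/-- The vertices of the cell of the permutohedral lattice with given starting point and order of
directions. -/
def cellVertices {k : ℕ} (n : Fin k → ℤ) (σ : Equiv.Perm (Fin k)) : Set (sumZeroSpace k) :=
  Set.range fun j => latticePoint (staircase n σ j)

/-- The centre of the sphere through the vertices of a cell. -/
noncomputable def cellCenter {k : ℕ} (n : Fin k → ℤ) (σ : Equiv.Perm (Fin k)) : sumZeroSpace k :=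
  toSumZero k fun i => n i - (σ.symm i : ℕ) / k

/-- The radius of the sphere through the vertices of a cell. -/
noncomputable def cellRadius (k : ℕ) : ℝ :=
  √((∑ i : Fin k, ∑ j : Fin k, ((i : ℝ) - j) ^ 2) / (2 * k))

lemma cellRadius_nonneg (k : ℕ) : 0 ≤ cellRadius k :=
  Real.sqrt_nonneg _

section Cell

variable {k : ℕ} (n : Fin k → ℤ) (σ : Equiv.Perm (Fin k))

lemma mul_dist_cellCenter_sq (m : Fin k → ℤ) :
    2 * k * dist (latticePoint m) (cellCenter n σ) ^ 2 =
      ((∑ i, ∑ j, ((k * (m i - n i) + σ.symm i : ℤ) - (k * (m j - n j) + σ.symm j)) ^ 2 : ℤ) : ℝ) := by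
  rw [dist_eq_norm, latticePoint, cellCenter, ← map_sub, mul_norm_toSumZero_sq]
  push_cast
  refine Finset.sum_congr rfl fun i _ => Finset.sum_congr rfl fun j _ => ?_
  have hk : (k : ℝ) ≠ 0 := by exact_mod_cast i.pos.ne'
  simp only [Pi.sub_apply]
  field_simp
  ring

lemma mul_cellRadius_sq (hk : 0 < k) : 2 * k * cellRadius k ^ 2 =
    ((∑ i : Fin k, ∑ j : Fin k, ((i : ℤ) - j) ^ 2 : ℤ) : ℝ) := by
  rw [cellRadius, Real.sq_sqrt (by positivity)]
  have hk : (k : ℝ) ≠ 0 := by exact_mod_cast hk.ne'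
  push_cast
  field_simp

/-- The residues mod `k` are the distinct numbers `σ.symm i`. -/
lemma injective_mul_add_symm (m : Fin k → ℤ) :
    Function.Injective fun i => (k * (m i - n i) + σ.symm i : ℤ) := by
  intro i j h
  have h1 := congrArg (· % (k : ℤ)) h
  simp only [Int.mul_add_emod_self_left] at h1
  rw [Int.emod_eq_of_lt (by simp) (by simp), Int.emod_eq_of_lt (by simp) (by simp)] at h1
  exact σ.symm.injective (Fin.ext (by exact_mod_cast h1))

lemma cellRadius_le_dist : ∀ z ∈ permutohedralLattice k, cellRadius k ≤ dist z (cellCenter n σ) := by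
  intro z hz
  obtain ⟨m, rfl⟩ : z ∈ Set.range (latticePoint (k := k)) := range_latticePoint ▸ hz
  rcases Nat.eq_zero_or_pos k with rfl | hk
  · simp [cellRadius]
  have hk' : (0 : ℝ) < 2 * k := by positivity
  refine (sq_le_sq₀ (cellRadius_nonneg k) dist_nonneg).1 ((mul_le_mul_iff_right₀ hk').1 ?_)
  rw [mul_dist_cellCenter_sq, mul_cellRadius_sq hk]
  exact_mod_cast sum_sum_sq_sub_le (injective_mul_add_symm n σ m)

lemma latticePoint_mem_cellVertices_iff (hk : 0 < k) (m : Fin k → ℤ) :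
    latticePoint m ∈ cellVertices n σ ↔
      ∀ i j, |(k * (m i - n i) + σ.symm i : ℤ) - (k * (m j - n j) + σ.symm j)| < k := by
  constructor
  · rintro ⟨p, hp⟩ i j
    have h := (latticePoint_eq_iff _ _).1 hp i j
    have hi := (σ.symm i).isLt
    have hj := (σ.symm j).isLt
    simp only [staircase, Fin.lt_def] at h
    have : (k * (m i - n i) + σ.symm i : ℤ) - (k * (m j - n j) + σ.symm j) =
      k * ((if (σ.symm i : ℕ) < p then 1 else 0) - (if (σ.symm j : ℕ) < p then 1 else 0)) +
        (σ.symm i - σ.symm j) := by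
      linear_combination (-(k : ℤ)) * h
    rw [this, abs_lt]
    split_ifs <;> simp <;> constructor <;> omega
  · intro h
    -- If `d` is this difference, `|k d - (j - i)| < k` with `0 < j - i < k` leaves only `d = 0` or
    -- `d = 1`. So `m - n` read along `σ` drops at most once, by one.
    have key : ∀ i j : Fin k, i < j → m (σ i) - n (σ i) - (m (σ j) - n (σ j)) = 0 ∨
        m (σ i) - n (σ i) - (m (σ j) - n (σ j)) = 1 := by
      intro i j hij
      have h1 := abs_lt.1 (h (σ i) (σ j))
      simp only [Equiv.symm_apply_apply] at h1
      have hk' : (0 : ℤ) < k := by exact_mod_cast hk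
      have hij' : (i : ℕ) < j := hij
      have hj := j.isLt
      have h2 : (k : ℤ) * (m (σ i) - n (σ i) - (m (σ j) - n (σ j))) < k * 2 := by
        linarith [h1.2, (by omega : (j : ℤ) - i < k)]
      have h3 : (k : ℤ) * (-1) < k * (m (σ i) - n (σ i) - (m (σ j) - n (σ j))) := by
        linarith [h1.1, (by omega : (i : ℤ) - j < 0)]
      have h4 := lt_of_mul_lt_mul_left h2 hk'.le
      have h5 := lt_of_mul_lt_mul_left h3 hk'.le
      omega
    let l : Fin k := ⟨k - 1, by omega⟩
    have hl : ∀ i, i < l ∨ i = l := fun i => by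
      rw [← le_iff_lt_or_eq, Fin.le_def]
      simp only [l]
      omega
    -- `p` is the first place where the final value is attained: the position of the drop, and so
    -- the index of the staircase vertex.
    obtain ⟨p, hp, hmin⟩ : ∃ p : Fin k, m (σ p) - n (σ p) = m (σ l) - n (σ l) ∧
        ∀ i < p, m (σ i) - n (σ i) ≠ m (σ l) - n (σ l) := by
      obtain ⟨p, hp, hmin⟩ := WellFounded.has_min (wellFounded_lt (α := Fin k))
        {i | m (σ i) - n (σ i) = m (σ l) - n (σ l)} ⟨l, rfl⟩
      exact ⟨p, hp, fun i hi h => hmin i h hi⟩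
    have hval : ∀ i, m (σ i) - n (σ i) = m (σ l) - n (σ l) + if i < p then 1 else 0 := by
      intro i
      split_ifs with hip
      · have h1 := hmin i hip
        rcases hl i with h2 | h2
        · rcases key i l h2 with h3 | h3 <;> omega
        · exact absurd (by rw [h2]) h1
      · rcases (not_lt.1 hip).lt_or_eq with h1 | h1
        · rcases hl i with h2 | h2
          · rcases key i l h2 with h3 | h3 <;> rcases key p i h1 with h4 | h4 <;> omega
          · rw [h2]; ring
        · rw [← h1, hp]; ring
    refine ⟨p, (latticePoint_eq_iff _ _).2 fun i j => ?_⟩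
    have h1 := hval (σ.symm i)
    have h2 := hval (σ.symm j)
    simp only [Equiv.apply_symm_apply] at h1 h2
    simp only [staircase]
    linarith

lemma cellVertices_eq (hk : 0 < k) : cellVertices n σ =
    {z ∈ (permutohedralLattice k : Set (sumZeroSpace k)) |
      dist z (cellCenter n σ) = cellRadius k} := by
  have key : ∀ m, latticePoint m ∈ cellVertices n σ ↔
      dist (latticePoint m) (cellCenter n σ) = cellRadius k := by
    intro m
    have hk' : (2 * k : ℝ) ≠ 0 := by positivity
    rw [latticePoint_mem_cellVertices_iff n σ hk,
      ← sum_sum_sq_sub_eq_iff (injective_mul_add_symm n σ m),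
      ← sq_eq_sq₀ dist_nonneg (cellRadius_nonneg k), ← mul_right_inj' hk', mul_dist_cellCenter_sq,
      mul_cellRadius_sq hk, Int.cast_inj]
  ext z
  rw [← range_latticePoint]
  constructor
  · rintro ⟨j, rfl⟩
    exact ⟨⟨_, rfl⟩, (key _).1 ⟨j, rfl⟩⟩
  · rintro ⟨⟨m, rfl⟩, hm⟩
    exact (key m).2 hm

/-! ### Barycentric coordinates -/

/-- Telescoping over `i < j < N`; the `min` covers the empty range, needed for the induction. -/
lemma sum_range_sub_mul_ite (g : ℕ → ℝ) (i N : ℕ) :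
    ∑ j ∈ Finset.range N, (g j - g (j + 1)) * (if i < j then 1 else 0) = g (min (i + 1) N) - g N := by
  induction N with
  | zero => simp
  | succ N ih =>
    rw [Finset.sum_range_succ, ih]
    split_ifs with h
    · rw [min_eq_left (by omega), min_eq_left (by omega)]
      ring
    · rw [min_eq_right (by omega), min_eq_right (by omega)]
      ring

/-- Every point is an affine combination of the vertices of a given cell. -/
lemma exists_barycentric (hk : 0 < k) (y : Fin k → ℝ) : ∃ w : Fin k → ℝ, ∑ j, w j = 1 ∧
    ∑ j, w j • latticePoint (staircase n σ j) = toSumZero k y ∧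
    ((Antitone fun i => y (σ i) - n (σ i)) →
      (∀ i j, y (σ i) - n (σ i) ≤ 1 + (y (σ j) - n (σ j))) → ∀ j, 0 ≤ w j) := by
  let l : Fin k := ⟨k - 1, by omega⟩
  let f : Fin k → ℝ := fun i => y (σ i) - n (σ i)
  -- `g` lists `1 + f l, f 0, …, f l`, and the weights are its consecutive drops, with total `1`.
  -- The default `0` is never reached for indices up to `k`.
  let g : ℕ → ℝ := fun m => if m = 0 then 1 + f l else if h : m - 1 < k then f ⟨m - 1, h⟩ else 0
  have hg0 : g 0 = 1 + f l := by simp [g]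
  have hg : ∀ i : Fin k, g (i + 1) = f i := fun i => by simp [g]
  have hgk : g k = f l := by
    have := hg l
    simp only [l, Nat.sub_add_cancel hk] at this
    exact this
  have hsum : ∑ j : Fin k, (g j - g (j + 1)) = 1 := by
    rw [Fin.sum_univ_eq_sum_range (fun j => g j - g (j + 1)), Finset.sum_range_sub', hg0, hgk]
    ring
  refine ⟨fun j => g j - g (j + 1), hsum, ?_, fun hanti hle j => ?_⟩
  · simp only [latticePoint, ← map_smul, ← map_sum]
    -- The combination recovers `y` up to the constant `f l`, which `toSumZero` kills.
    have hval : ∀ i, (∑ j : Fin k, (g j - g (j + 1)) • fun i => ((staircase n σ j i : ℤ) : ℝ)) i =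
        y i - f l := by
      intro i
      have h1 := sum_range_sub_mul_ite g (σ.symm i) k
      rw [← Fin.sum_univ_eq_sum_range
        (fun j => (g j - g (j + 1)) * (if (σ.symm i : ℕ) < j then 1 else 0)),
        min_eq_left (Nat.succ_le_of_lt (σ.symm i).isLt), hg, hgk] at h1
      simp only [Finset.sum_apply, Pi.smul_apply, smul_eq_mul, staircase, Int.cast_add, Int.cast_ite,
        Int.cast_one, Int.cast_zero, mul_add, Finset.sum_add_distrib, ← Finset.sum_mul, hsum,
        Fin.lt_def]
      rw [h1]
      simp only [f, Equiv.apply_symm_apply]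
      ring
    rw [toSumZero_eq_iff]
    intro i j
    rw [hval, hval]
    ring
  · rw [sub_nonneg, hg]
    rcases j with ⟨_ | j, hj⟩
    · change f _ ≤ g 0
      rw [hg0]
      exact hle _ _
    · rw [show g ((⟨j + 1, hj⟩ : Fin k) : ℕ) = f ⟨j, by omega⟩ from hg ⟨j, by omega⟩]
      exact hanti (Fin.le_def.2 (by simp))

lemma affineSpan_cellVertices (hk : 0 < k) : affineSpan ℝ (cellVertices n σ) = ⊤ := by
  rw [eq_top_iff]
  intro x _
  obtain ⟨y, rfl⟩ := toSumZero_surjective x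
  obtain ⟨w, hw, hwy, -⟩ := exists_barycentric n σ hk y
  rw [← hwy, ← Finset.affineCombination_eq_linear_combination _ _ _ hw]
  exact affineCombination_mem_affineSpan hw _

lemma finrank_sumZeroSpace (hk : 0 < k) : Module.finrank ℝ (sumZeroSpace k) + 1 = k := by
  let f : Module.Dual ℝ (EuclideanSpace ℝ (Fin k)) :=
    { toFun := fun x => ∑ i, x i
      map_add' := fun x y => by simp [Finset.sum_add_distrib]
      map_smul' := fun c x => by simp [Finset.mul_sum] }
  have hf : f ≠ 0 := by
    intro h
    have := LinearMap.congr_fun h (EuclideanSpace.single ⟨0, hk⟩ 1)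
    simp [f] at this
  have hker : sumZeroSpace k = LinearMap.ker f := rfl
  rw [hker, Module.Dual.finrank_ker_add_one_of_ne_zero hf]
  simp

/-- These `k` points span a space of dimension `k - 1`. -/
lemma affineIndependent_cellVertices (hk : 0 < k) :
    AffineIndependent ℝ fun j => latticePoint (staircase n σ j) := by
  have hcard : Fintype.card (Fin k) = Module.finrank ℝ (sumZeroSpace k) + 1 := by
    rw [finrank_sumZeroSpace hk, Fintype.card_fin]
  rw [affineIndependent_iff_le_finrank_vectorSpan ℝ _ hcard]
  have h := affineSpan_cellVertices n σ hk
  rw [cellVertices] at h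
  rw [← direction_affineSpan, h, AffineSubspace.direction_top, finrank_top]

end Cell

lemma exists_mem_convexHull_cellVertices {k : ℕ} (hk : 0 < k) (x : sumZeroSpace k) :
    ∃ n σ, x ∈ convexHull ℝ (cellVertices (k := k) n σ) := by
  obtain ⟨y, rfl⟩ := toSumZero_surjective x
  let n : Fin k → ℤ := fun i => ⌊y i⌋
  let σ := Tuple.sort fun i => -Int.fract (y i)
  obtain ⟨w, hw1, hwy, hw0⟩ := exists_barycentric n σ hk y
  refine ⟨n, σ, ?_⟩
  rw [← hwy]
  refine (convex_convexHull ℝ _).sum_mem (fun j _ => hw0 ?_ ?_ j) hw1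
    fun j _ => subset_convexHull ℝ _ ⟨j, rfl⟩
  · intro i j hij
    have := Tuple.monotone_sort (fun i => -Int.fract (y i)) hij
    exact neg_le_neg_iff.1 this
  · intro i j
    have h1 := (Int.fract_lt_one (y (σ i))).le
    have h2 := Int.fract_nonneg (y (σ j))
    rw [Int.fract] at h1 h2
    simp only [n]
    linarith

/-! ### The Delone triangulation -/

lemma isDeloneCell_cellVertices {k : ℕ} (hk : 0 < k) (n : Fin k → ℤ) (σ : Equiv.Perm (Fin k)) :
    IsDeloneCell (permutohedralLattice k : Set (sumZeroSpace k)) (cellVertices n σ) :=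
  ⟨cellCenter n σ, cellRadius k, cellRadius_le_dist n σ, cellVertices_eq n σ hk,
    affineSpan_cellVertices n σ hk⟩

lemma IsDeloneCell.subset_cellVertices {k : ℕ} (hk : 0 < k) {P : Set (sumZeroSpace k)}
    (hP : IsDeloneCell (permutohedralLattice k : Set (sumZeroSpace k)) P) :
    ∃ n σ, P ⊆ cellVertices (k := k) n σ := by
  obtain ⟨c, r, hc, rfl, hspan⟩ := hP
  -- An independent spanning subset is finite, so it has a centroid, which some staircase cell
  -- contains.
  obtain ⟨t, htP, ht, hind⟩ := exists_affineIndependent ℝ (sumZeroSpace k)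
    {z ∈ (permutohedralLattice k : Set (sumZeroSpace k)) | dist z c = r}
  rw [hspan] at ht
  have hfin : t.Finite := finite_set_of_fin_dim_affineIndependent ℝ hind
  lift t to Finset (sumZeroSpace k) using hfin
  have hne : t.Nonempty := by
    rw [Finset.nonempty_iff_ne_empty]
    rintro rfl
    simp at ht
  obtain ⟨n, σ, hx⟩ := exists_mem_convexHull_cellVertices hk (∑ v ∈ t, (t.card : ℝ)⁻¹ • v)
  refine ⟨n, σ, ?_⟩
  rw [cellVertices_eq n σ hk] at hx ⊢
  exact subset_of_centroid_mem_convexHull hc (cellRadius_le_dist n σ) htP hne ht hx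

/-- The Delone triangulation of the permutohedral lattice. -/
def deloneComplex {k : ℕ} (hk : 0 < k) : Geometry.SimplicialComplex ℝ (sumZeroSpace k) where
  faces := {s | s.Nonempty ∧ ∃ n σ, (s : Set (sumZeroSpace k)) ⊆ cellVertices (k := k) n σ}
  isRelLowerSet_faces := fun _ ⟨hne, n, σ, hs⟩ =>
    ⟨hne, fun _ hts ht => ⟨ht, n, σ, (Finset.coe_subset.2 hts).trans hs⟩⟩
  indep := fun ⟨_, n, σ, hs⟩ => (affineIndependent_cellVertices n σ hk).range.mono hs
  inter_subset_convexHull := by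
    classical
    rintro s t ⟨-, n, σ, hs⟩ ⟨-, n', σ', ht⟩ x ⟨hxs, hxt⟩
    let T : Finset (sumZeroSpace k) := Finset.univ.image fun j => latticePoint (staircase n σ j)
    have hT : (T : Set (sumZeroSpace k)) = cellVertices n σ := by simp [T, cellVertices]
    have hind : AffineIndependent ℝ ((↑) : T → sumZeroSpace k) := by
      have := (affineIndependent_cellVertices n σ hk).range
      change AffineIndependent ℝ ((↑) : cellVertices n σ → sumZeroSpace k) at this
      rwa [← hT] at this
    have hs' := hs
    have ht' := ht
    rw [cellVertices_eq _ _ hk] at hs' ht'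
    -- This moves `x` into the hull of the vertices of `t` in the cell of `s`; within one simplex,
    -- faces meet in the hull of their common vertices.
    have h1 := mem_convexHull_inter_of_mem_convexHull (cellRadius_le_dist n' σ')
      (cellRadius_le_dist n σ) ht' hxt (convexHull_mono hs' hxs)
    rw [← cellVertices_eq _ _ hk, ← hT, ← Finset.coe_inter] at h1
    rw [← hT, Finset.coe_subset] at hs
    have h2 := hind.convexHull_inter hs (Finset.inter_subset_right (s₁ := t))
    have h3 := h2.ge ⟨hxs, h1⟩
    refine convexHull_mono ?_ h3
    rw [Finset.coe_inter]
    exact Set.inter_subset_inter_right _ Set.inter_subset_left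

lemma isDeloneTriangulation_deloneComplex {k : ℕ} (hk : 0 < k) :
    IsDeloneTriangulation (permutohedralLattice k : Set (sumZeroSpace k)) (deloneComplex hk) where
  space_eq := by
    classical
    rw [Set.eq_univ_iff_forall]
    intro x
    obtain ⟨n, σ, hx⟩ := exists_mem_convexHull_cellVertices hk x
    have hT : ((Finset.univ.image fun j => latticePoint (staircase n σ j) :
      Finset (sumZeroSpace k)) : Set (sumZeroSpace k)) = cellVertices n σ := by simp [cellVertices]
    refine Geometry.SimplicialComplex.mem_space_iff.2
      ⟨Finset.univ.image fun j => latticePoint (staircase n σ j), ⟨?_, n, σ, hT.le⟩, ?_⟩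
    · exact ⟨_, Finset.mem_image_of_mem _ (Finset.mem_univ ⟨0, hk⟩)⟩
    · rwa [hT]
  mem_faces_iff := fun s => by
    refine and_congr_right fun _ => ⟨?_, ?_⟩
    · rintro ⟨n, σ, hs⟩
      exact ⟨_, isDeloneCell_cellVertices hk n σ, hs⟩
    · rintro ⟨P, hP, hs⟩
      obtain ⟨n, σ, hPn⟩ := hP.subset_cellVertices hk
      exact ⟨n, σ, hs.trans hPn⟩

/-! ### Components of the tonnetz -/

section Tonnetz

variable {k : ℕ} (L : Fin k → ℝ) (x : UnitAddCircle)

/-- The point of the circle reached from `x` by `n i` steps of length `L i`, for all `i`. -/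
noncomputable def circlePoint (n : Fin k → ℤ) : UnitAddCircle :=
  x + ((∑ i, n i * L i : ℝ) : UnitAddCircle)

lemma circlePoint_add (n m : Fin k → ℤ) :
    circlePoint L x (n + m) = circlePoint L (circlePoint L x n) m := by
  simp only [circlePoint, add_assoc, ← AddCircle.coe_add]
  simp [add_mul, Finset.sum_add_distrib]

lemma circlePoint_staircase (n : Fin k → ℤ) (σ : Equiv.Perm (Fin k)) (j : Fin k) :
    circlePoint L x (staircase n σ j) =
      circlePoint L x n + ((∑ i ∈ Finset.Iio j, L (σ i) : ℝ) : UnitAddCircle) := by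
  have h : ∑ i, (if σ.symm i < j then 1 else 0) * L i = ∑ i ∈ Finset.Iio j, L (σ i) := by
    rw [← Equiv.sum_comp σ]
    simp only [Equiv.symm_apply_apply, ite_mul, one_mul, zero_mul]
    rw [← Finset.sum_filter]
    congr 1
    ext i
    simp
  simp only [circlePoint, staircase, add_assoc, ← AddCircle.coe_add]
  simp [add_mul, Finset.sum_add_distrib, ← h]

lemma maximalSimplex_circlePoint (n : Fin k → ℤ) (σ : Equiv.Perm (Fin k)) :
    maximalSimplex L (circlePoint L x n) σ = Set.range fun j => circlePoint L x (staircase n σ j) := by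
  simp only [circlePoint_staircase]
  rfl

variable {L}

/-- Equality on the circle means that `∑ (n i - m i) L i` is an integer `c`. As `c = ∑ c L i`,
irrationality forces `n i - m i = c` for all `i`. -/
lemma circlePoint_eq_iff (hsum : ∑ i, L i = 1)
    (hirr : ∀ p : Fin k → ℤ, p ≠ 0 → ∑ i, (p i : ℝ) * L i ≠ 0) (n m : Fin k → ℤ) :
    circlePoint L x n = circlePoint L x m ↔ ∀ i j, n i - m i = n j - m j := by
  have hL : ∀ c : ℤ, ∑ i, (n i - m i - c : ℤ) * L i = (∑ i, n i * L i - ∑ i, m i * L i) - c := by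
    intro c
    push_cast
    simp only [sub_mul, Finset.sum_sub_distrib, ← Finset.mul_sum, hsum, mul_one]
  have h0 : circlePoint L x n = circlePoint L x m ↔
      ∃ c : ℤ, (c : ℝ) = ∑ i, n i * L i - ∑ i, m i * L i := by
    rw [circlePoint, circlePoint, add_right_inj, ← sub_eq_zero, ← AddCircle.coe_sub,
      AddCircle.coe_eq_zero_iff]
    simp
  rw [h0]
  constructor
  · rintro ⟨c, hc⟩
    have h : (fun i => n i - m i - c) = 0 := by
      by_contra h
      apply hirr _ h
      rw [hL, hc, sub_self]
    have h' : ∀ i, n i - m i = c := fun i => sub_eq_zero.1 (congrFun h i)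
    intro i j
    rw [h', h']
  · intro h
    rcases Nat.eq_zero_or_pos k with rfl | hk
    · simp at hsum
    refine ⟨n ⟨0, hk⟩ - m ⟨0, hk⟩, ?_⟩
    have h1 := hL (n ⟨0, hk⟩ - m ⟨0, hk⟩)
    rw [Finset.sum_eq_zero fun i _ => by rw [h i ⟨0, hk⟩]; simp] at h1
    linarith

lemma reachable_of_subset_maximalSimplex {u v y : UnitAddCircle} {σ : Equiv.Perm (Fin k)}
    (hu : u ∈ maximalSimplex L y σ) (hv : v ∈ maximalSimplex L y σ) :
    (skeletonGraph (fullTonnetz L)).Reachable u v := by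
  classical
  by_cases h : u = v
  · rw [h]
  · refine SimpleGraph.Adj.reachable ⟨h, {u, v}, ⟨⟨u, by simp⟩, y, σ, ?_⟩, by simp, by simp⟩
    intro z hz
    rcases Finset.mem_insert.1 (Finset.mem_coe.1 hz) with rfl | hz
    · exact hu
    · rwa [Finset.mem_singleton.1 hz]

lemma mem_maximalSimplex_self (hk : 0 < k) (y : UnitAddCircle) (σ : Equiv.Perm (Fin k)) :
    y ∈ maximalSimplex L y σ := by
  refine ⟨⟨0, hk⟩, ?_⟩
  have : Finset.Iio (⟨0, hk⟩ : Fin k) = ∅ := by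
    ext i
    simp [Fin.lt_def]
  simp [this]

lemma reachable_circlePoint_single (hsum : ∑ i, L i = 1) (y : UnitAddCircle) (i : Fin k) :
    (skeletonGraph (fullTonnetz L)).Reachable y (circlePoint L y (Pi.single i 1)) := by
  have hk : 0 < k := i.pos
  have hval : circlePoint L y (Pi.single i 1) = y + (L i : UnitAddCircle) := by
    simp [circlePoint, Pi.single_apply]
  rw [hval]
  -- The swap makes `L i` the first step. When `k = 1` that step is a full turn.
  let σ : Equiv.Perm (Fin k) := Equiv.swap ⟨0, hk⟩ i
  refine reachable_of_subset_maximalSimplex (y := y) (σ := σ) (mem_maximalSimplex_self hk y σ) ?_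
  by_cases h1 : 1 < k
  · refine ⟨⟨1, h1⟩, ?_⟩
    have : Finset.Iio (⟨1, h1⟩ : Fin k) = {⟨0, hk⟩} := by
      ext i
      simp [Fin.lt_def, Fin.ext_iff]
    simp [this, σ]
  · obtain rfl : k = 1 := by omega
    have : L i = 1 := by
      rw [← hsum, Fin.sum_univ_one, Subsingleton.elim i 0]
    rw [this, AddCircle.coe_period, add_zero]
    exact mem_maximalSimplex_self hk y σ

lemma reachable_circlePoint (hsum : ∑ i, L i = 1) (m : Fin k → ℤ) (y : UnitAddCircle) :
    (skeletonGraph (fullTonnetz L)).Reachable y (circlePoint L y m) := by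
  -- Quantifying over all base points makes these vectors a subgroup; it contains the unit vectors.
  let G : AddSubgroup (Fin k → ℤ) :=
    { carrier := {m | ∀ y, (skeletonGraph (fullTonnetz L)).Reachable y (circlePoint L y m)}
      zero_mem' := fun y => by simp [circlePoint]
      add_mem' := fun {m m'} hm hm' y => by
        rw [circlePoint_add]
        exact (hm y).trans (hm' _)
      neg_mem' := fun {m} hm y => by
        have h := hm (circlePoint L y (-m))
        rw [← circlePoint_add, neg_add_cancel] at h
        simpa [circlePoint] using h.symm }
  suffices h : m ∈ G from h y
  have hm : m = ∑ i, m i • Pi.single i (1 : ℤ) := by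
    ext j
    simp [Finset.sum_apply, Pi.single_apply]
  rw [hm]
  exact sum_mem fun i _ => zsmul_mem (K := G) (fun y => reachable_circlePoint_single hsum y i) _

lemma exists_circlePoint_of_mem_maximalSimplex {y : UnitAddCircle} {σ : Equiv.Perm (Fin k)}
    {n : Fin k → ℤ} (h : circlePoint L x n ∈ maximalSimplex L y σ) :
    ∃ m, y = circlePoint L x m := by
  obtain ⟨j, hj⟩ := h
  -- Undo the first `j` steps of the staircase.
  refine ⟨fun i => n i - if σ.symm i < j then 1 else 0, ?_⟩
  have h := circlePoint_staircase L x (fun i => n i - if σ.symm i < j then 1 else 0) σ j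
  have hs : staircase (fun i => n i - if σ.symm i < j then 1 else 0) σ j = n := by
    ext i
    simp [staircase]
  rw [hs, ← hj] at h
  exact add_right_cancel h

lemma reachable_iff (hsum : ∑ i, L i = 1) (v : UnitAddCircle) :
    (skeletonGraph (fullTonnetz L)).Reachable x v ↔ v ∈ Set.range (circlePoint L x) := by
  constructor
  · rintro ⟨w⟩
    suffices h : ∀ u v, (skeletonGraph (fullTonnetz L)).Walk u v →
        u ∈ Set.range (circlePoint L x) → v ∈ Set.range (circlePoint L x) from
      h x v w ⟨0, by simp [circlePoint]⟩
    intro u v w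
    induction w with
    | nil => exact id
    | cons hadj _ ih =>
      rintro ⟨n, rfl⟩
      apply ih
      obtain ⟨-, s, ⟨-, y, σ, hs⟩, hu, hv⟩ := hadj
      obtain ⟨m, rfl⟩ := exists_circlePoint_of_mem_maximalSimplex x (hs hu)
      have hv' := hs hv
      rw [maximalSimplex_circlePoint] at hv'
      obtain ⟨j, hj⟩ := hv'
      exact ⟨_, hj⟩
  · rintro ⟨n, rfl⟩
    exact reachable_circlePoint hsum n x

lemma range_circlePoint (hk : 0 < k) (hsum : ∑ i, L i = 1) :
    Set.range (circlePoint L x) = vertexSet (component (fullTonnetz L) x) := by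
  ext v
  rw [← reachable_iff x hsum]
  constructor
  · intro h
    exact ⟨⟨⟨v, by simp⟩, v, 1, by simpa using mem_maximalSimplex_self hk v 1⟩, by simpa using h⟩
  · intro h
    exact h.2 v (by simp)

lemma range_latticePoint_eq_vertexSet (hk : 0 < k) :
    Set.range (latticePoint (k := k)) =
      vertexSet (deloneComplex hk).toPreAbstractSimplicialComplex := by
  ext v
  constructor
  · rintro ⟨n, rfl⟩
    refine ⟨⟨_, Finset.mem_singleton_self _⟩, n, 1, ?_⟩
    rw [Finset.coe_singleton, Set.singleton_subset_iff]
    refine ⟨⟨0, hk⟩, ?_⟩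
    refine congrArg latticePoint (funext fun i => ?_)
    simp [staircase, Fin.lt_def]
  · rintro ⟨-, n, σ, h⟩
    obtain ⟨j, hj⟩ := h (Finset.mem_coe.2 (Finset.mem_singleton_self v))
    exact ⟨_, hj⟩

lemma image_mem_faces_iff (hk : 0 < k) (hsum : ∑ i, L i = 1)
    (hirr : ∀ p : Fin k → ℤ, p ≠ 0 → ∑ i, (p i : ℝ) * L i ≠ 0)
    [DecidableEq UnitAddCircle] [DecidableEq (sumZeroSpace k)] (s : Finset (Fin k → ℤ)) :
    s.image (circlePoint L x) ∈ (component (fullTonnetz L) x).faces ↔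
      s.image latticePoint ∈ (deloneComplex hk).faces := by
  have hker : ∀ n m, circlePoint L x n = circlePoint L x m ↔ latticePoint n = latticePoint m :=
    fun n m => by rw [circlePoint_eq_iff x hsum hirr, latticePoint_eq_iff]
  have hcell : ∀ n σ, (s.image (circlePoint L x) : Set UnitAddCircle) ⊆
        maximalSimplex L (circlePoint L x n) σ ↔
      (s.image latticePoint : Set (sumZeroSpace k)) ⊆ cellVertices n σ := by
    intro n σ
    rw [maximalSimplex_circlePoint, cellVertices]
    simp only [Finset.coe_image, Set.subset_def, Set.forall_mem_image, Set.mem_range, hker]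
  constructor
  · rintro ⟨⟨hne, y, σ, hs⟩, -⟩
    have hne' := Finset.image_nonempty.1 hne
    refine ⟨Finset.image_nonempty.2 hne', ?_⟩
    obtain ⟨m, hm⟩ := hne'
    obtain ⟨n, rfl⟩ := exists_circlePoint_of_mem_maximalSimplex x
      (hs (Finset.mem_coe.2 (Finset.mem_image_of_mem _ hm)))
    exact ⟨n, σ, (hcell n σ).1 hs⟩
  · rintro ⟨hne, n, σ, hs⟩
    refine ⟨⟨Finset.image_nonempty.2 (Finset.image_nonempty.1 hne), _, σ, (hcell n σ).2 hs⟩, ?_⟩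
    intro v hv
    obtain ⟨m, -, rfl⟩ := Finset.mem_image.1 hv
    exact reachable_circlePoint hsum m x

end Tonnetz

end Tonnetz

theorem mainTheorem4 (k : ℕ) (L : Fin k → ℝ)
    (hpos : ∀ i, 0 < L i)
    (hsum : ∑ i, L i = 1)
    (hirr : ∀ p : Fin k → ℤ, p ≠ 0 → ∑ i, (p i : ℝ) * L i ≠ 0) :
    ∃ D : Geometry.SimplicialComplex ℝ (Tonnetz.sumZeroSpace k),
      Tonnetz.IsDeloneTriangulation (Tonnetz.permutohedralLattice k : Set (Tonnetz.sumZeroSpace k)) D ∧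
      ∀ x : UnitAddCircle,
        Tonnetz.Isomorphic (Tonnetz.component (Tonnetz.fullTonnetz L) x)
          D.toPreAbstractSimplicialComplex := by
  classical
  have hk : 0 < k := by
    rcases Nat.eq_zero_or_pos k with rfl | hk
    · simp at hsum
    · exact hk
  refine ⟨Tonnetz.deloneComplex hk, Tonnetz.isDeloneTriangulation_deloneComplex hk, fun x => ?_⟩
  exact Tonnetz.isomorphic_of_parametrisation (Tonnetz.circlePoint L x) Tonnetz.latticePoint
    (Tonnetz.range_circlePoint x hk hsum) (Tonnetz.range_latticePoint_eq_vertexSet hk)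
    (fun n m => by rw [Tonnetz.circlePoint_eq_iff x hsum hirr, Tonnetz.latticePoint_eq_iff])
    (Tonnetz.image_mem_faces_iff x hk hsum hirr)
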